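/- Let $\hbar>0$, let $\mathcal W_\hbar$ be the first Weyl algebra, i.e. the unital complex $*$-algebra generated by $U=U^*$ and $V=V^*$ with $[U,V]=i\hbar 1$, and let $\mathfrak F_\hbar$ be its fraction skew field with the induced involution. Let $\mathfrak g_2$ be the abelian Lie algebra spanned by the hermitian derivations $\partial_u f=\frac1{i\hbar}[f,V]$ and $\partial_v f=\frac1{i\hbar}[U,f]$ of $\mathfrak F_\hbar$, and put $\partial=\frac12(\partial_u-i\partial_v)$, $\bar\partial=\frac12(\partial_u+i\partial_v)$. For a derivation $d$ write $d^*(f)=(d(f^*))^*$. Let $X^1,\dots,X^n\in\mathfrak F_\hbar$ be hermitian. For $d\in\mathfrak g_2$ let $\varphi(d)=(dX^1,\dots,dX^n)\in\mathfrak F_\hbar^n$, let $T\Sigma\subseteq\mathfrak F_\hbar^n$ be the right submodule generated by all $\varphi(d)$, and let $h(A,B)=\sum_{i}(A^i)^*B^i$ on $T\Sigma$. Put $e_u=\varphi(\partial_u)$, $e_v=\varphi(\partial_v)$, and assume that $\Sigma=(\mathfrak F_\hbar,\mathfrak g_2,\{X^i\})$ is a noncommutative minimal surface: $$\partial_u^2X^i+\partial_v^2X^i=0\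 (1\le i\le n),\qquad h(e_u,e_u)=h(e_v,e_v),\qquad -h(e_u,e_v)^*=h(e_u,e_v).$$ Put $\Phi=\varphi(\partial)$, $\bar\Phi=\varphi(\bar\partial)$, $S=h(\Phi,\Phi)$, $T=h(\bar\Phi,\bar\Phi)$. Assume that $S\ne0$ and $T\neq0$, and that $[\Phi^i,\partial\Phi^i]=0$ for $i=1,\dots,n$. A connection on $T\Sigma$ is a map $\nabla:\mathfrak g_2\times T\Sigma\to T\Sigma$, $(d,m)\mapsto\nabla_dm$, that is additive in $m$, $\mathbb C$-linear in $d$, and satisfies $\nabla_d(ma)=(\nabla_dm)a+m\,d(a)$. It is a Levi-Civita connection on $(T\Sigma,h)$ if, for all $d,d_1,d_2\in\mathfrak g_2$ and $m_1,m_2\in T\Sigma$, $$d\,h(m_1,m_2)=h(\nabla_{d^*}m_1,m_2)+h(m_1,\nabla_dm_2),\qquad \nabla_{d_1}\varphi(d_2)-\nabla_{d_2}\varphi(d_1)=\varphi([d_1,d_2]).$$ Then for arbitrary $\tilde\gamma_1,\tilde\gamma_2\in\mathfrak F_\hbar$ there is exactly one connection $\nabla$ on $T\Sigma$ with $$\begin{aligned}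 \nabla_{\partial}\Phi&=\Phi S^{-1}\partial S+i\Phi S^{-1}\tilde\gamma_1+i\bar\Phi T^{-1}\tilde\gamma_2,\\ \nabla_{\bar\partial}\bar\Phi&=\bar\Phi T^{-1}\bar\partial T+i\Phi S^{-1}\tilde\gamma_2^*+i\bar\Phi T^{-1}\tilde\gamma_1^*,\\ \nabla_{\partial}\bar\Phi&=i\Phi S^{-1}\tilde\gamma_1^*+i\bar\Phi T^{-1}\tilde\gamma_1=\nabla_{\bar\partial}\Phi, \end{aligned}$$ and it is a Levi-Civita connection on $(T\Sigma,h)$. -/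

import Mathlib

namespace NCMinimal

open scoped nonZeroDivisors

/-- The defining relation `U V - V U = iħ 1` of the first Weyl algebra. -/
inductive WeylRel (ħ : ℝ) : FreeAlgebra ℂ (Fin 2) → FreeAlgebra ℂ (Fin 2) → Prop
  | comm : WeylRel ħ
      (FreeAlgebra.ι ℂ 0 * FreeAlgebra.ι ℂ 1 - FreeAlgebra.ι ℂ 1 * FreeAlgebra.ι ℂ 0)
      (algebraMap ℂ _ (Complex.I * (ħ : ℂ)))

/-- The first Weyl algebra: the unital complex algebra generated by `U` and `V`
subject to `[U, V] = iħ 1`. -/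
def WeylAlgebra (ħ : ℝ) : Type := RingQuot (WeylRel ħ)

namespace WeylAlgebra

variable (ħ : ℝ)

noncomputable instance : Ring (WeylAlgebra ħ) := inferInstanceAs (Ring (RingQuot (WeylRel ħ)))

noncomputable instance : Algebra ℂ (WeylAlgebra ħ) :=
  inferInstanceAs (Algebra ℂ (RingQuot (WeylRel ħ)))

/-- The quotient map from the free algebra. -/
noncomputable def mk : FreeAlgebra ℂ (Fin 2) →ₐ[ℂ] WeylAlgebra ħ :=
  RingQuot.mkAlgHom ℂ (WeylRel ħ)

theorem mk_surjective : Function.Surjective (mk ħ) := RingQuot.mkAlgHom_surjective ℂ _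

/-- The generator `U`. -/
noncomputable def U : WeylAlgebra ħ := mk ħ (FreeAlgebra.ι ℂ 0)

/-- The generator `V`. -/
noncomputable def V : WeylAlgebra ħ := mk ħ (FreeAlgebra.ι ℂ 1)

theorem U_mul_V_sub : U ħ * V ħ - V ħ * U ħ = algebraMap ℂ _ (Complex.I * (ħ : ℂ)) := by
  have h := RingQuot.mkAlgHom_rel ℂ (WeylRel.comm (ħ := ħ))
  have h' : mk ħ _ = mk ħ _ := h
  simpa [U, V, AlgHom.commutes] using h'

variable {ħ}

theorem hom_ext {B : Type*} [Semiring B] [Algebra ℂ B] {f g : WeylAlgebra ħ →ₐ[ℂ] B}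
    (hU : f (U ħ) = g (U ħ)) (hV : f (V ħ) = g (V ħ)) : f = g := by
  apply RingQuot.ringQuot_ext' ℂ
  apply FreeAlgebra.hom_ext
  funext i
  fin_cases i
  · exact hU
  · exact hV

/-- The universal property of the Weyl algebra. -/
noncomputable def lift {B : Type*} [Ring B] [Algebra ℂ B] (u v : B)
    (h : u * v - v * u = algebraMap ℂ B (Complex.I * (ħ : ℂ))) : WeylAlgebra ħ →ₐ[ℂ] B :=
  RingQuot.liftAlgHom ℂ ⟨FreeAlgebra.lift ℂ ![u, v], by
    rintro _ _ ⟨⟩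
    simpa [AlgHom.commutes] using h⟩

@[simp] theorem lift_U {B : Type*} [Ring B] [Algebra ℂ B] (u v : B)
    (h : u * v - v * u = algebraMap ℂ B (Complex.I * (ħ : ℂ))) : lift u v h (U ħ) = u := by
  have := RingQuot.liftAlgHom_mkAlgHom_apply ℂ (FreeAlgebra.lift ℂ ![u, v]) (s := WeylRel ħ)
    (by rintro _ _ ⟨⟩; simpa [AlgHom.commutes] using h) (FreeAlgebra.ι ℂ 0)
  exact this.trans (by simp)

@[simp] theorem lift_V {B : Type*} [Ring B] [Algebra ℂ B] (u v : B)
    (h : u * v - v * u = algebraMap ℂ B (Complex.I * (ħ : ℂ))) : lift u v h (V ħ) = v := by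
  have := RingQuot.liftAlgHom_mkAlgHom_apply ℂ (FreeAlgebra.lift ℂ ![u, v]) (s := WeylRel ħ)
    (by rintro _ _ ⟨⟩; simpa [AlgHom.commutes] using h) (FreeAlgebra.ι ℂ 1)
  exact this.trans (by simp)

@[elab_as_elim]
theorem induction {C : WeylAlgebra ħ → Prop} (halg : ∀ z : ℂ, C (algebraMap ℂ _ z))
    (hU : C (U ħ)) (hV : C (V ħ)) (hmul : ∀ a b, C a → C b → C (a * b))
    (hadd : ∀ a b, C a → C b → C (a + b)) (a : WeylAlgebra ħ) : C a := by
  obtain ⟨a, rfl⟩ := mk_surjective ħ a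
  induction a using FreeAlgebra.induction with
  | grade0 r => simpa using halg r
  | grade1 x =>
    fin_cases x
    · exact hU
    · exact hV
  | mul a b ha hb => simpa using hmul _ _ ha hb
  | add a b ha hb => simpa using hadd _ _ ha hb

/-! ### The involution -/

variable (ħ) in
/-- The opposite of the Weyl algebra, as a complex algebra through the conjugate scalars. -/
def Conj : Type := (WeylAlgebra ħ)ᵐᵒᵖ

noncomputable instance : Ring (Conj ħ) := inferInstanceAs (Ring (WeylAlgebra ħ)ᵐᵒᵖ)

noncomputable instance : Algebra ℂ (Conj ħ) :=
  RingHom.toAlgebra'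
    (((algebraMap ℂ (WeylAlgebra ħ)ᵐᵒᵖ).comp (starRingEnd ℂ) : ℂ →+* (WeylAlgebra ħ)ᵐᵒᵖ) :
      ℂ →+* Conj ħ)
    (fun c x => Algebra.commutes (A := (WeylAlgebra ħ)ᵐᵒᵖ) (starRingEnd ℂ c) x)

theorem conj_algebraMap (z : ℂ) : (algebraMap ℂ (Conj ħ) z : (WeylAlgebra ħ)ᵐᵒᵖ) =
    MulOpposite.op (algebraMap ℂ (WeylAlgebra ħ) (starRingEnd ℂ z)) := rfl

variable (ħ) in
/-- The antilinear antiautomorphism fixing `U` and `V`, as a homomorphism to `Conj ħ`. -/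
noncomputable def starHom : WeylAlgebra ħ →ₐ[ℂ] Conj ħ :=
  lift (B := Conj ħ) (MulOpposite.op (U ħ)) (MulOpposite.op (V ħ)) (by
    rw [conj_algebraMap]
    change MulOpposite.op (V ħ * U ħ - U ħ * V ħ) = _
    rw [← neg_sub, U_mul_V_sub]
    simp)

/-- The involution as a plain function. -/
noncomputable def starFun (a : WeylAlgebra ħ) : WeylAlgebra ħ := MulOpposite.unop (starHom ħ a)

theorem starFun_mul (a b : WeylAlgebra ħ) : starFun (a * b) = starFun b * starFun a := by
  simp only [starFun, map_mul]; rfl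

theorem starFun_add (a b : WeylAlgebra ħ) : starFun (a + b) = starFun a + starFun b := by
  simp only [starFun, map_add]; rfl

theorem starFun_algebraMap (z : ℂ) : starFun (algebraMap ℂ (WeylAlgebra ħ) z) =
    algebraMap ℂ _ (starRingEnd ℂ z) := by
  simp only [starFun, AlgHom.commutes]; rfl

theorem starFun_U : starFun (U ħ) = U ħ := by
  exact congrArg MulOpposite.unop (lift_U (B := Conj ħ) _ _ _)

theorem starFun_V : starFun (V ħ) = V ħ := by
  exact congrArg MulOpposite.unop (lift_V (B := Conj ħ) _ _ _)

theorem starFun_starFun (a : WeylAlgebra ħ) : starFun (starFun a) = a := by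
  induction a using induction with
  | halg z => simp [starFun_algebraMap]
  | hU => simp [starFun_U]
  | hV => simp [starFun_V]
  | hmul a b ha hb => rw [starFun_mul, starFun_mul, ha, hb]
  | hadd a b ha hb => rw [starFun_add, starFun_add, ha, hb]

/-- The `*`-structure with `U* = U` and `V* = V`. -/
noncomputable instance : StarRing (WeylAlgebra ħ) where
  star := starFun
  star_involutive := starFun_starFun
  star_mul := starFun_mul
  star_add := starFun_add

theorem star_U : star (U ħ) = U ħ := starFun_U
theorem star_V : star (V ħ) = V ħ := starFun_V
theorem star_algebraMap (z : ℂ) : star (algebraMap ℂ (WeylAlgebra ħ) z) =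
    algebraMap ℂ _ (starRingEnd ℂ z) := starFun_algebraMap z

instance : StarModule ℂ (WeylAlgebra ħ) where
  star_smul z a := by
    rw [Algebra.smul_def, star_mul, star_algebraMap, Algebra.smul_def, Algebra.commutes]; rfl

/-! ### The Weyl algebra is a domain -/

open Polynomial in
variable (ħ) in
/-- The left regular representation, written on ordered polynomials: `U` is the variable of the
outer polynomial ring and `V` that of its coefficient ring. -/
noncomputable def rep : WeylAlgebra ħ →ₐ[ℂ] Module.End ℂ ℂ[X][X] :=
  lift (LinearMap.mulLeft ℂ (X : ℂ[X][X]))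
    (LinearMap.mulLeft ℂ (C X : ℂ[X][X]) -
      (Complex.I * (ħ : ℂ)) • (Polynomial.derivative (R := ℂ[X])).restrictScalars ℂ) (by
    ext1 p
    simp only [LinearMap.sub_apply, Module.End.mul_apply, LinearMap.mulLeft_apply,
      LinearMap.smul_apply, LinearMap.restrictScalars_apply, derivative_mul, derivative_X,
      Module.algebraMap_end_apply, mul_sub, smul_add, mul_smul_comm, one_mul]
    ring)

open Polynomial

theorem rep_U (p : ℂ[X][X]) : rep ħ (U ħ) p = X * p := by simp [rep]

theorem rep_V (p : ℂ[X][X]) : rep ħ (V ħ) p =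
    C X * p - (Complex.I * (ħ : ℂ)) • derivative p := by simp [rep]

theorem rep_U_pow (i : ℕ) (p : ℂ[X][X]) : rep ħ (U ħ ^ i) p = X ^ i * p := by
  induction i with
  | zero => simp
  | succ i ih => rw [pow_succ', map_mul, Module.End.mul_apply, ih, rep_U, pow_succ', mul_assoc]

theorem rep_V_pow (j N : ℕ) (p : ℂ[X][X]) (hp : p.natDegree ≤ N) :
    (rep ħ (V ħ ^ j) p).natDegree ≤ N ∧ (rep ħ (V ħ ^ j) p).coeff N = X ^ j * p.coeff N := by
  induction j with
  | zero => simpa using hp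
  | succ j ih =>
    rw [pow_succ', map_mul, Module.End.mul_apply, rep_V]
    set q := rep ħ (V ħ ^ j) p
    have hd : (derivative q).coeff N = 0 := by
      rw [coeff_derivative, coeff_eq_zero_of_natDegree_lt (lt_of_le_of_lt ih.1 N.lt_succ_self),
        zero_mul]
    constructor
    · refine (natDegree_sub_le _ _).trans (max_le ?_ ?_)
      · exact (natDegree_C_mul_le _ _).trans ih.1
      · exact (natDegree_smul_le _ _).trans
          ((natDegree_derivative_le q).trans ((Nat.sub_le _ _).trans ih.1))
    · rw [coeff_sub, coeff_smul, hd, smul_zero, sub_zero, coeff_C_mul, ih.2, pow_succ', mul_assoc]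

theorem rep_aeval_V (f : ℂ[X]) (N : ℕ) (p : ℂ[X][X]) (hp : p.natDegree ≤ N) :
    (rep ħ (aeval (V ħ) f) p).natDegree ≤ N ∧
      (rep ħ (aeval (V ħ) f) p).coeff N = f * p.coeff N := by
  induction f using Polynomial.induction_on' with
  | add f g hf hg =>
    rw [map_add, map_add, LinearMap.add_apply]
    exact ⟨(natDegree_add_le _ _).trans (max_le hf.1 hg.1), by rw [coeff_add, hf.2, hg.2, add_mul]⟩
  | monomial j c =>
    obtain ⟨h1, h2⟩ := rep_V_pow (ħ := ħ) j N p hp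
    rw [aeval_monomial, map_mul, Module.End.mul_apply, AlgHom.commutes,
      Module.algebraMap_end_apply]
    refine ⟨(natDegree_smul_le _ _).trans h1, ?_⟩
    rw [coeff_smul, h2, ← C_mul_X_pow_eq_monomial, smul_eq_C_mul, mul_assoc]

variable (ħ) in
/-- The ordered monomial expansion: an ordered polynomial as an element of the Weyl algebra. -/
noncomputable def ofPoly (p : ℂ[X][X]) : WeylAlgebra ħ :=
  p.sum fun i f => U ħ ^ i * aeval (V ħ) f

theorem rep_ofPoly_coeff (p q : ℂ[X][X]) :
    (rep ħ (ofPoly ħ p) q).coeff (p.natDegree + q.natDegree) =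
      p.leadingCoeff * q.leadingCoeff := by
  rw [ofPoly, Polynomial.sum, map_sum, LinearMap.sum_apply, finsetSum_coeff]
  have key : ∀ i ∈ p.support, (rep ħ (U ħ ^ i * aeval (V ħ) (p.coeff i)) q).coeff
      (p.natDegree + q.natDegree) =
      if i = p.natDegree then p.leadingCoeff * q.leadingCoeff else 0 := by
    intro i hi
    obtain ⟨h1, h2⟩ := rep_aeval_V (ħ := ħ) (p.coeff i) q.natDegree q le_rfl
    have hip := le_natDegree_of_mem_supp i hi
    rw [map_mul, Module.End.mul_apply, rep_U_pow]
    split_ifs with h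
    · subst h
      rw [add_comm, coeff_X_pow_mul, h2]; rfl
    · apply coeff_eq_zero_of_natDegree_lt
      refine (natDegree_mul_le).trans_lt ?_
      rw [natDegree_X_pow]
      omega
  rw [Finset.sum_congr rfl key, Finset.sum_ite_eq']
  split_ifs with h
  · rfl
  · have : p = 0 := by
      by_contra hp
      exact h (natDegree_mem_support_of_nonzero hp)
    simp [this]

theorem rep_ofPoly_ne_zero {p q : ℂ[X][X]} (hp : p ≠ 0) (hq : q ≠ 0) :
    rep ħ (ofPoly ħ p) q ≠ 0 := by
  intro h
  have := rep_ofPoly_coeff (ħ := ħ) p q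
  rw [h, coeff_zero] at this
  exact mul_ne_zero (leadingCoeff_ne_zero.2 hp) (leadingCoeff_ne_zero.2 hq) this.symm

variable (ħ) in
/-- The span of the ordered monomials of degree less than `n` in each variable. -/
noncomputable def box (n : ℕ) : Submodule ℂ (WeylAlgebra ħ) :=
  Submodule.span ℂ (Set.range fun p : Fin n × Fin n => U ħ ^ (p.1 : ℕ) * V ħ ^ (p.2 : ℕ))

theorem mem_box {n i j : ℕ} (hi : i < n) (hj : j < n) : U ħ ^ i * V ħ ^ j ∈ box ħ n :=
  Submodule.subset_span ⟨(⟨i, hi⟩, ⟨j, hj⟩), rfl⟩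

theorem box_mono {m n : ℕ} (h : m ≤ n) : box ħ m ≤ box ħ n := by
  rw [box, Submodule.span_le]
  rintro _ ⟨p, rfl⟩
  exact mem_box (p.1.2.trans_le h) (p.2.2.trans_le h)

theorem V_pow_mul_U (j : ℕ) : V ħ ^ j * U ħ =
    U ħ * V ħ ^ j - ((j : ℂ) * (Complex.I * (ħ : ℂ))) • V ħ ^ (j - 1) := by
  have h : V ħ * U ħ = U ħ * V ħ - (Complex.I * (ħ : ℂ)) • (1 : WeylAlgebra ħ) := by
    rw [← Algebra.algebraMap_eq_smul_one, ← U_mul_V_sub]; abel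
  induction j with
  | zero => simp
  | succ j ih =>
    rw [pow_succ', mul_assoc, ih, mul_sub, ← mul_assoc, h, sub_mul, mul_smul_comm]
    rcases j with _ | j
    · simp
    · rw [Nat.add_sub_cancel, Nat.add_sub_cancel, ← pow_succ', smul_mul_assoc, one_mul, mul_assoc,
        sub_sub, ← add_smul]
      congr 2
      push_cast
      ring

theorem box_mul_U {n : ℕ} {w : WeylAlgebra ħ} (hw : w ∈ box ħ n) : w * U ħ ∈ box ħ (n + 1) := by
  induction hw using Submodule.span_induction with
  | mem x hx =>
    obtain ⟨p, rfl⟩ := hx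
    have h1 := p.1.2
    have h2 := p.2.2
    simp only [mul_assoc, V_pow_mul_U, mul_sub, mul_smul_comm]
    rw [← mul_assoc, ← pow_succ]
    exact sub_mem (mem_box (by omega) (by omega))
      (Submodule.smul_mem _ _ (mem_box (by omega) (by omega)))
  | zero => simp
  | add x y _ _ hx hy => rw [add_mul]; exact add_mem hx hy
  | smul c x _ hx => rw [smul_mul_assoc]; exact Submodule.smul_mem _ _ hx

theorem box_mul_V {n : ℕ} {w : WeylAlgebra ħ} (hw : w ∈ box ħ n) : w * V ħ ∈ box ħ (n + 1) := by
  induction hw using Submodule.span_induction with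
  | mem x hx =>
    obtain ⟨p, rfl⟩ := hx
    have h1 := p.1.2
    have h2 := p.2.2
    simp only [mul_assoc, ← pow_succ]
    exact mem_box (by omega) (by omega)
  | zero => simp
  | add x y _ _ hx hy => rw [add_mul]; exact add_mem hx hy
  | smul c x _ hx => rw [smul_mul_assoc]; exact Submodule.smul_mem _ _ hx

theorem exists_box_mul (a : WeylAlgebra ħ) :
    ∃ d : ℕ, ∀ n, ∀ w ∈ box ħ n, w * a ∈ box ħ (n + d) := by
  induction a using induction with
  | halg z =>
    refine ⟨0, fun n w hw => ?_⟩
    rw [← Algebra.commutes, ← Algebra.smul_def]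
    exact Submodule.smul_mem _ _ hw
  | hU => exact ⟨1, fun n w hw => box_mul_U hw⟩
  | hV => exact ⟨1, fun n w hw => box_mul_V hw⟩
  | hmul a b ha hb =>
    obtain ⟨d, hd⟩ := ha
    obtain ⟨e, he⟩ := hb
    refine ⟨d + e, fun n w hw => ?_⟩
    rw [← mul_assoc, ← add_assoc]
    exact he _ _ (hd _ _ hw)
  | hadd a b ha hb =>
    obtain ⟨d, hd⟩ := ha
    obtain ⟨e, he⟩ := hb
    refine ⟨d + e, fun n w hw => ?_⟩
    rw [mul_add]
    exact add_mem (box_mono (by omega) (hd _ _ hw)) (box_mono (by omega) (he _ _ hw))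

theorem exists_ofPoly (a : WeylAlgebra ħ) : ∃ p, ofPoly ħ p = a := by
  obtain ⟨d, hd⟩ := exists_box_mul a
  have h1 : (1 : WeylAlgebra ħ) ∈ box ħ 1 := by
    simpa using mem_box (ħ := ħ) (n := 1) (i := 0) (j := 0) one_pos one_pos
  have ha := hd 1 1 h1
  rw [one_mul] at ha
  clear hd
  have hadd : ∀ p q, ofPoly ħ (p + q) = ofPoly ħ p + ofPoly ħ q := fun p q =>
    sum_add_index p q _ (by simp) (by simp [mul_add])
  have hmon : ∀ i f, ofPoly ħ (monomial i f) = U ħ ^ i * aeval (V ħ) f := fun i f =>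
    sum_monomial_index f _ (by simp)
  have hsmul : ∀ (c : ℂ) p, ofPoly ħ (c • p) = c • ofPoly ħ p := by
    intro c p
    induction p using Polynomial.induction_on' with
    | add p q hp hq => rw [smul_add, hadd, hp, hq, hadd, smul_add]
    | monomial i f => rw [smul_monomial, hmon, hmon, map_smul, mul_smul_comm]
  induction ha using Submodule.span_induction with
  | mem x hx =>
    obtain ⟨p, rfl⟩ := hx
    exact ⟨monomial p.1 (X ^ (p.2 : ℕ)), by rw [hmon]; simp⟩
  | zero => exact ⟨0, by simp [ofPoly]⟩
  | add x y _ _ hx hy =>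
    obtain ⟨p, rfl⟩ := hx
    obtain ⟨q, rfl⟩ := hy
    exact ⟨p + q, hadd p q⟩
  | smul c x _ hx =>
    obtain ⟨p, rfl⟩ := hx
    exact ⟨c • p, hsmul c p⟩

instance : Nontrivial (WeylAlgebra ħ) := (rep ħ).toRingHom.domain_nontrivial

instance : NoZeroDivisors (WeylAlgebra ħ) where
  eq_zero_or_eq_zero_of_mul_eq_zero {a b} hab := by
    obtain ⟨p, rfl⟩ := exists_ofPoly a
    obtain ⟨q, rfl⟩ := exists_ofPoly b
    by_contra! h
    have hp : p ≠ 0 := fun hp => h.1 (by simp [hp, ofPoly])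
    have hq : q ≠ 0 := fun hq => h.2 (by simp [hq, ofPoly])
    have h0 := congrArg (fun w => rep ħ w (1 : ℂ[X][X])) hab
    simp only [map_mul, Module.End.mul_apply, map_zero, LinearMap.zero_apply] at h0
    exact rep_ofPoly_ne_zero hp (rep_ofPoly_ne_zero hq one_ne_zero) h0

/-! ### The Ore condition -/

theorem rep_V_pow_one (j : ℕ) : rep ħ (V ħ ^ j) 1 = C (X ^ j) := by
  induction j with
  | zero => simp
  | succ j ih =>
    rw [pow_succ', map_mul, Module.End.mul_apply, ih, rep_V, derivative_C, smul_zero, sub_zero,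
      ← C_mul, pow_succ']

theorem finrank_box (n : ℕ) : Module.finrank ℂ (box ħ n) = n * n := by
  have hli : LinearIndependent ℂ
      (fun p : Fin n × Fin n => U ħ ^ (p.1 : ℕ) * V ħ ^ (p.2 : ℕ)) := by
    rw [Fintype.linearIndependent_iff]
    intro c hc p
    have h := congrArg (fun w => ((rep ħ w (1 : ℂ[X][X])).coeff p.1).coeff p.2) hc
    simp only [map_sum, map_smul, map_mul, LinearMap.sum_apply, LinearMap.smul_apply,
      Module.End.mul_apply, rep_V_pow_one, rep_U_pow, finsetSum_coeff, coeff_smul, coeff_mul_C,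
      coeff_X_pow, map_zero, LinearMap.zero_apply, coeff_zero] at h
    rw [Finset.sum_eq_single p] at h
    · simpa using h
    · rintro q - hq
      by_cases h1 : (p.1 : ℕ) = q.1
      · have h2 : (p.2 : ℕ) ≠ q.2 := fun h2 => hq (Prod.ext (Fin.ext h1.symm) (Fin.ext h2.symm))
        simp [h1, coeff_X_pow, h2]
      · simp [h1]
    · simp
  rw [box, finrank_span_eq_card hli]
  simp

instance (n : ℕ) : Module.Finite ℂ (box ħ n) :=
  Module.Finite.span_of_finite ℂ (Set.finite_range _)

theorem ore_condition (r : WeylAlgebra ħ) (s : (WeylAlgebra ħ)⁰) :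
    ∃ (r' : WeylAlgebra ħ) (s' : (WeylAlgebra ħ)⁰), s' * r = r' * s := by
  obtain ⟨d, hd⟩ := exists_box_mul r
  obtain ⟨e, he⟩ := exists_box_mul (s : WeylAlgebra ħ)
  set k := d + e + 1 with hk
  let F : (box ħ (3 * k) × box ħ (3 * k)) →ₗ[ℂ] box ħ (4 * k) :=
    LinearMap.codRestrict _
      (((LinearMap.mulRight ℂ r).comp (box ħ (3 * k)).subtype).comp (LinearMap.fst ℂ _ _) -
        ((LinearMap.mulRight ℂ (s : WeylAlgebra ħ)).comp (box ħ (3 * k)).subtype).comp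
          (LinearMap.snd ℂ _ _))
      (fun w => sub_mem (box_mono (by omega) (hd _ _ w.1.2)) (box_mono (by omega) (he _ _ w.2.2)))
  have hker : LinearMap.ker F ≠ ⊥ := by
    apply LinearMap.ker_ne_bot_of_finrank_lt
    rw [Module.finrank_prod, finrank_box, finrank_box]
    nlinarith
  obtain ⟨w, hw, hw0⟩ := Submodule.exists_mem_ne_zero_of_ne_bot hker
  have hF : (w.1 : WeylAlgebra ħ) * r - (w.2 : WeylAlgebra ħ) * s = 0 :=
    congrArg Subtype.val (LinearMap.mem_ker.1 hw)
  have hs : (s : WeylAlgebra ħ) ≠ 0 := nonZeroDivisors.coe_ne_zero s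
  have h1 : (w.1 : WeylAlgebra ħ) ≠ 0 := by
    intro h1
    rw [h1, zero_mul, zero_sub, neg_eq_zero, mul_eq_zero, or_iff_left hs] at hF
    exact hw0 (Prod.ext (Subtype.ext h1) (Subtype.ext hF))
  exact ⟨w.2, ⟨w.1, mem_nonZeroDivisors_of_ne_zero h1⟩, sub_eq_zero.1 hF⟩

noncomputable instance : OreLocalization.OreSet (WeylAlgebra ħ)⁰ :=
  (OreLocalization.nonempty_oreSet_iff_of_noZeroDivisors.2 ore_condition).some

end WeylAlgebra

end NCMinimal

namespace NCMinimal

open scoped nonZeroDivisors RightActions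

/-! ### The fraction skew field of the Weyl algebra -/

/-- The fraction skew field of the Weyl algebra, as the Ore localization at all nonzero
elements. -/
def FractionField (ħ : ℝ) : Type := OreLocalization (WeylAlgebra ħ)⁰ (WeylAlgebra ħ)

namespace FractionField

variable {ħ : ℝ}

noncomputable instance : DivisionRing (FractionField ħ) :=
  inferInstanceAs (DivisionRing (OreLocalization (WeylAlgebra ħ)⁰ (WeylAlgebra ħ)))

noncomputable instance : Algebra ℂ (FractionField ħ) :=
  inferInstanceAs (Algebra ℂ (OreLocalization (WeylAlgebra ħ)⁰ (WeylAlgebra ħ)))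

/-- The inclusion of the Weyl algebra in its fraction field. -/
noncomputable def incl : WeylAlgebra ħ →ₐ[ℂ] FractionField ħ where
  toRingHom := OreLocalization.numeratorRingHom (R := WeylAlgebra ħ) (S := (WeylAlgebra ħ)⁰)
  commutes' _ := rfl

theorem incl_injective : Function.Injective (incl : WeylAlgebra ħ → FractionField ħ) :=
  OreLocalization.numeratorHom_inj (fun _ hx => (mem_nonZeroDivisors_iff.1 hx).1)

/-- The involution of the Weyl algebra, followed by the inclusion. -/
noncomputable def starIncl : WeylAlgebra ħ →+* (FractionField ħ)ᵐᵒᵖ :=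
  (RingHom.op (incl : WeylAlgebra ħ →ₐ[ℂ] FractionField ħ).toRingHom).comp
    (starRingEquiv : WeylAlgebra ħ ≃+* (WeylAlgebra ħ)ᵐᵒᵖ).toRingHom

theorem starIncl_apply (w : WeylAlgebra ħ) : starIncl w = MulOpposite.op (incl (star w)) := rfl

theorem starIncl_ne_zero (s : (WeylAlgebra ħ)⁰) : starIncl (s : WeylAlgebra ħ) ≠ 0 := by
  rw [starIncl_apply, Ne, MulOpposite.op_eq_zero_iff, map_eq_zero_iff _ incl_injective,
    star_eq_zero]
  exact nonZeroDivisors.coe_ne_zero s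

/-- The values of `starIncl` on nonzero elements, as units. -/
noncomputable def starUnits : (WeylAlgebra ħ)⁰ →* ((FractionField ħ)ᵐᵒᵖ)ˣ where
  toFun s := Units.mk0 (starIncl (s : WeylAlgebra ħ)) (starIncl_ne_zero s)
  map_one' := Units.ext (by simp)
  map_mul' s t := Units.ext (by simp)

/-- The extension of the involution of the Weyl algebra to the fraction field, as a ring
homomorphism to the opposite ring. -/
noncomputable def starHom : FractionField ħ →+* (FractionField ħ)ᵐᵒᵖ :=
  OreLocalization.universalHom (R := WeylAlgebra ħ) (S := (WeylAlgebra ħ)⁰) starIncl starUnits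
    (fun _ => rfl)

theorem starHom_incl (w : WeylAlgebra ħ) :
    starHom (incl w) = MulOpposite.op (incl (star w)) :=
  OreLocalization.universalHom_commutes (R := WeylAlgebra ħ) (S := (WeylAlgebra ħ)⁰) starIncl
    starUnits (fun _ => rfl)

/-- Every element is a left fraction `s⁻¹ r`. -/
theorem exists_fraction (x : FractionField ħ) :
    ∃ s r : WeylAlgebra ħ, s ≠ 0 ∧ x = (incl s)⁻¹ * incl r := by
  refine OreLocalization.ind (fun r s => ?_) x
  have hs : (s : WeylAlgebra ħ) ≠ 0 := nonZeroDivisors.coe_ne_zero s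
  have hs' : (incl (s : WeylAlgebra ħ) : FractionField ħ) ≠ 0 :=
    (map_ne_zero_iff _ incl_injective).2 hs
  exact ⟨s, r, hs, (eq_inv_mul_iff_mul_eq₀ hs').2
    (OreLocalization.mul_cancel (R := WeylAlgebra ħ) (S := (WeylAlgebra ħ)⁰) (r := r) (s := s))⟩

theorem starHom_starHom (x : FractionField ħ) :
    (starHom (starHom x).unop).unop = x := by
  obtain ⟨s, r, -, rfl⟩ := exists_fraction x
  simp [starHom_incl]

/-- The involution of the fraction field, extending that of the Weyl algebra. -/
noncomputable instance : StarRing (FractionField ħ) where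
  star x := (starHom x).unop
  star_involutive := starHom_starHom
  star_mul x y := by
    change (starHom (x * y)).unop = _
    rw [map_mul]; rfl
  star_add x y := by
    change (starHom (x + y)).unop = _
    rw [map_add]; rfl

theorem star_incl (w : WeylAlgebra ħ) :
    star (incl w : FractionField ħ) = incl (star w) :=
  congrArg MulOpposite.unop (starHom_incl w)

instance : StarModule ℂ (FractionField ħ) where
  star_smul z x := by
    have h : star (algebraMap ℂ (FractionField ħ) z) = algebraMap ℂ _ (star z) := by
      rw [← AlgHom.commutes (incl : WeylAlgebra ħ →ₐ[ℂ] FractionField ħ), star_incl,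
        WeylAlgebra.star_algebraMap, AlgHom.commutes]; rfl
    rw [Algebra.smul_def, star_mul, h, ← Algebra.commutes, ← Algebra.smul_def]

end FractionField

/-! ### Lie pairs, hermitian forms and connections over a `*`-algebra

Right modules over `A` are modules over `Aᵐᵒᵖ`, and `m <• a` is the right action. -/

section General

variable {A : Type*} [Ring A] [StarRing A] [Algebra ℂ A] [StarModule ℂ A]

/-- The map `d* : f ↦ (d (f*))*`. -/
def starEnd (d : Module.End ℂ A) : Module.End ℂ A where
  toFun f := star (d (star f))
  map_add' f g := by simp
  map_smul' z f := by simp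

variable (A) in
/-- A Lie pair `(A, 𝔤)`: a complex Lie algebra `𝔤` of derivations of the `*`-algebra `A` (with
the commutator as bracket) that is closed under `d ↦ d*`. -/
structure LiePair where
  /-- The underlying space of linear endomorphisms. -/
  carrier : Submodule ℂ (Module.End ℂ A)
  leibniz : ∀ d ∈ carrier, ∀ a b : A, d (a * b) = d a * b + a * d b
  bracket_mem : ∀ d₁ ∈ carrier, ∀ d₂ ∈ carrier, d₁ * d₂ - d₂ * d₁ ∈ carrier
  star_mem : ∀ d ∈ carrier, starEnd d ∈ carrier

namespace LiePair

variable (g : LiePair A)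

/-- The bracket `[d₁, d₂]`. -/
def bracket (d₁ d₂ : g.carrier) : g.carrier :=
  ⟨(d₁ : Module.End ℂ A) * d₂ - (d₂ : Module.End ℂ A) * d₁, g.bracket_mem _ d₁.2 _ d₂.2⟩

/-- The involution `d ↦ d*`. -/
def involution (d : g.carrier) : g.carrier := ⟨starEnd d, g.star_mem _ d.2⟩

end LiePair

variable (A) in
/-- A hermitian form on a right `A`-module. -/
structure HermitianForm (M : Type*) [AddCommGroup M] [Module Aᵐᵒᵖ M] where
  /-- The underlying function. -/
  toFun : M → M → A
  star_apply : ∀ m₁ m₂, star (toFun m₁ m₂) = toFun m₂ m₁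
  apply_smul : ∀ m₁ m₂ a, toFun m₁ (m₂ <• a) = toFun m₁ m₂ * a
  add_apply : ∀ m₁ m₂ m, toFun (m₁ + m₂) m = toFun m₁ m + toFun m₂ m

instance {M : Type*} [AddCommGroup M] [Module Aᵐᵒᵖ M] :
    CoeFun (HermitianForm A M) fun _ => M → M → A := ⟨HermitianForm.toFun⟩

/-- The restriction of a hermitian form to a submodule. -/
def HermitianForm.restrict {M : Type*} [AddCommGroup M] [Module Aᵐᵒᵖ M] (h : HermitianForm A M)
    (N : Submodule Aᵐᵒᵖ M) : HermitianForm A N where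
  toFun m₁ m₂ := h m₁ m₂
  star_apply _ _ := h.star_apply _ _
  apply_smul _ _ _ := h.apply_smul _ _ _
  add_apply _ _ _ := h.add_apply _ _ _

variable (A) in
/-- The standard hermitian form `(U, V) ↦ ∑ i, (U i)* V i` on the free right module `A ^ n`. -/
def stdForm (n : ℕ) : HermitianForm A (Fin n → A) where
  toFun u v := ∑ i, star (u i) * v i
  star_apply u v := by simp [star_sum]
  apply_smul u v a := by simp [Finset.sum_mul, mul_assoc]
  add_apply u v w := by simp [add_mul, Finset.sum_add_distrib]

/-- A connection on a right `A`-module with respect to a Lie pair. A complex number `z` acts on a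
right module as the element `z 1` of `A`. -/
structure Connection (g : LiePair A) (M : Type*) [AddCommGroup M] [Module Aᵐᵒᵖ M] where
  /-- The covariant derivative `∇ d m`. -/
  toFun : g.carrier → M → M
  map_add : ∀ d m₁ m₂, toFun d (m₁ + m₂) = toFun d m₁ + toFun d m₂
  linear : ∀ (z₁ z₂ : ℂ) (d₁ d₂ : g.carrier) (m : M),
    toFun (z₁ • d₁ + z₂ • d₂) m =
      toFun d₁ m <• algebraMap ℂ A z₁ + toFun d₂ m <• algebraMap ℂ A z₂
  leibniz : ∀ (d : g.carrier) (m : M) (a : A),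
    toFun d (m <• a) = toFun d m <• a + m <• (d : Module.End ℂ A) a

instance {g : LiePair A} {M : Type*} [AddCommGroup M] [Module Aᵐᵒᵖ M] :
    CoeFun (Connection g M) fun _ => g.carrier → M → M := ⟨Connection.toFun⟩

/-- Compatibility of a connection with a hermitian form. -/
def Connection.IsHermitian {g : LiePair A} {M : Type*} [AddCommGroup M] [Module Aᵐᵒᵖ M]
    (nabla : Connection g M) (h : HermitianForm A M) : Prop :=
  ∀ (d : g.carrier) (m₁ m₂ : M),
    (d : Module.End ℂ A) (h m₁ m₂) = h (nabla (g.involution d) m₁) m₂ + h m₁ (nabla d m₂)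

/-- An embedded noncommutative manifold `(A, 𝔤, {X¹, …, Xⁿ})`: hermitian elements
`X¹, …, Xⁿ` of the algebra of a Lie pair. -/
structure EmbeddedManifold (g : LiePair A) (n : ℕ) where
  /-- The embedding coordinates. -/
  X : Fin n → A
  isSelfAdjoint : ∀ i, IsSelfAdjoint (X i)

namespace EmbeddedManifold

variable {g : LiePair A} {n : ℕ} (E : EmbeddedManifold g n)

/-- The module `TΣ` of vector fields: the right submodule of `A ^ n` generated by all
`d X = (d X¹, …, d Xⁿ)`, for `d` in `𝔤`. -/
def tangent : Submodule Aᵐᵒᵖ (Fin n → A) :=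
  Submodule.span Aᵐᵒᵖ (Set.range fun (d : g.carrier) (i : Fin n) => (d : Module.End ℂ A) (E.X i))

/-- The map `φ : 𝔤 → TΣ`, `φ(d) = d X`. -/
def phi (d : g.carrier) : E.tangent :=
  ⟨fun i => (d : Module.End ℂ A) (E.X i), Submodule.subset_span ⟨d, rfl⟩⟩

/-- The hermitian form on `TΣ`: the restriction of the standard form on `A ^ n`. -/
def h : HermitianForm A E.tangent := (stdForm A n).restrict E.tangent

variable {E} in
/-- Torsion freeness of a connection on `TΣ`. -/
def IsTorsionFree (nabla : Connection g E.tangent) : Prop :=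
  ∀ d₁ d₂ : g.carrier, nabla d₁ (E.phi d₂) - nabla d₂ (E.phi d₁) = E.phi (g.bracket d₁ d₂)

variable {E} in
/-- A Levi-Civita connection on `(TΣ, h)`: a hermitian and torsion free connection. -/
def IsLeviCivita (nabla : Connection g E.tangent) : Prop :=
  nabla.IsHermitian E.h ∧ IsTorsionFree nabla

end EmbeddedManifold

end General

/-! ### The derivations of the fraction field -/

section Derivations

variable (ħ : ℝ)

/-- The derivation `∂_u = (1 / iħ) [·, V]`. -/
noncomputable def du : Module.End ℂ (FractionField ħ) :=
  (Complex.I * (ħ : ℂ))⁻¹ • (LinearMap.mulRight ℂ (FractionField.incl (WeylAlgebra.V ħ)) -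
    LinearMap.mulLeft ℂ (FractionField.incl (WeylAlgebra.V ħ)))

/-- The derivation `∂_v = (1 / iħ) [U, ·]`. -/
noncomputable def dv : Module.End ℂ (FractionField ħ) :=
  (Complex.I * (ħ : ℂ))⁻¹ • (LinearMap.mulLeft ℂ (FractionField.incl (WeylAlgebra.U ħ)) -
    LinearMap.mulRight ℂ (FractionField.incl (WeylAlgebra.U ħ)))

theorem du_apply (f : FractionField ħ) : du ħ f = (Complex.I * (ħ : ℂ))⁻¹ •
    (f * FractionField.incl (WeylAlgebra.V ħ) - FractionField.incl (WeylAlgebra.V ħ) * f) := rfl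

theorem dv_apply (f : FractionField ħ) : dv ħ f = (Complex.I * (ħ : ℂ))⁻¹ •
    (FractionField.incl (WeylAlgebra.U ħ) * f - f * FractionField.incl (WeylAlgebra.U ħ)) := rfl

theorem du_mul (a b : FractionField ħ) : du ħ (a * b) = du ħ a * b + a * du ħ b := by
  simp only [du_apply, smul_mul_assoc, mul_smul_comm, ← smul_add]
  congr 1
  noncomm_ring

theorem dv_mul (a b : FractionField ħ) : dv ħ (a * b) = dv ħ a * b + a * dv ħ b := by
  simp only [dv_apply, smul_mul_assoc, mul_smul_comm, ← smul_add]
  congr 1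
  noncomm_ring

theorem starEnd_du : starEnd (du ħ) = du ħ := by
  ext f
  change star (du ħ (star f)) = _
  simp only [du_apply, star_smul, star_sub, star_mul, star_star, FractionField.star_incl,
    WeylAlgebra.star_V]
  rw [← neg_sub, smul_neg, ← neg_smul]
  congr 1
  simp

theorem starEnd_dv : starEnd (dv ħ) = dv ħ := by
  ext f
  change star (dv ħ (star f)) = _
  simp only [dv_apply, star_smul, star_sub, star_mul, star_star, FractionField.star_incl,
    WeylAlgebra.star_U]
  rw [← neg_sub, smul_neg, ← neg_smul]
  congr 1
  simp

theorem du_dv_comm : du ħ * dv ħ = dv ħ * du ħ := by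
  ext f
  have hUV : FractionField.incl (WeylAlgebra.U ħ) * FractionField.incl (WeylAlgebra.V ħ) =
      FractionField.incl (WeylAlgebra.V ħ) * FractionField.incl (WeylAlgebra.U ħ) +
        algebraMap ℂ (FractionField ħ) (Complex.I * (ħ : ℂ)) := by
    rw [← map_mul, ← map_mul, ← AlgHom.commutes FractionField.incl, ← WeylAlgebra.U_mul_V_sub,
      ← map_add, add_sub_cancel]
  have hc := Algebra.commutes (Complex.I * (ħ : ℂ)) f
  set u := FractionField.incl (WeylAlgebra.U ħ)
  set v := FractionField.incl (WeylAlgebra.V ħ)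
  set c := algebraMap ℂ (FractionField ħ) (Complex.I * (ħ : ℂ))
  simp only [Module.End.mul_apply, du_apply, dv_apply, smul_mul_assoc, mul_smul_comm, ← smul_sub]
  congr 2
  have h1 : u * v * f = v * u * f + c * f := by rw [hUV, add_mul]
  have h2 : f * u * v = f * v * u + f * c := by rw [mul_assoc, hUV, mul_add, ← mul_assoc]
  have e1 : (u * f - f * u) * v - v * (u * f - f * u) =
      u * f * v - f * u * v - v * u * f + v * f * u := by noncomm_ring
  have e2 : u * (f * v - v * f) - (f * v - v * f) * u =
      u * f * v - u * v * f - f * v * u + v * f * u := by noncomm_ring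
  rw [e1, e2, h1, h2, hc]
  abel

/-- The Lie pair of the fraction field with the abelian Lie algebra `𝔤₂` spanned by the hermitian
derivations `∂_u` and `∂_v`. -/
noncomputable def g2 : LiePair (FractionField ħ) where
  carrier := Submodule.span ℂ {du ħ, dv ħ}
  leibniz d hd a b := by
    obtain ⟨x, y, rfl⟩ := Submodule.mem_span_pair.1 hd
    simp only [LinearMap.add_apply, LinearMap.smul_apply, du_mul, dv_mul, smul_add, add_mul,
      mul_add, smul_mul_assoc, mul_smul_comm]
    abel
  bracket_mem d₁ h₁ d₂ h₂ := by
    obtain ⟨x, y, rfl⟩ := Submodule.mem_span_pair.1 h₁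
    obtain ⟨x', y', rfl⟩ := Submodule.mem_span_pair.1 h₂
    convert Submodule.zero_mem _ using 1
    simp only [mul_add, add_mul, smul_mul_assoc, mul_smul_comm, smul_add, du_dv_comm]
    module
  star_mem d hd := by
    obtain ⟨x, y, rfl⟩ := Submodule.mem_span_pair.1 hd
    have h : starEnd (x • du ħ + y • dv ħ) = star x • starEnd (du ħ) + star y • starEnd (dv ħ) := by
      ext f
      simp [starEnd]
    rw [h, starEnd_du, starEnd_dv]
    exact Submodule.mem_span_pair.2 ⟨_, _, rfl⟩

/-- `∂_u` as an element of `𝔤₂`. -/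
noncomputable def delU : (g2 ħ).carrier := ⟨du ħ, Submodule.subset_span (by simp)⟩

/-- `∂_v` as an element of `𝔤₂`. -/
noncomputable def delV : (g2 ħ).carrier := ⟨dv ħ, Submodule.subset_span (by simp)⟩

/-- `∂ = (∂_u - i ∂_v) / 2`. -/
noncomputable def del : (g2 ħ).carrier := (1 / 2 : ℂ) • (delU ħ - Complex.I • delV ħ)

/-- `∂̄ = (∂_u + i ∂_v) / 2`. -/
noncomputable def delBar : (g2 ħ).carrier := (1 / 2 : ℂ) • (delU ħ + Complex.I • delV ħ)

end Derivations

/-! ### Noncommutative minimal surfaces -/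

namespace EmbeddedManifold

variable {ħ : ℝ} {n : ℕ} (E : EmbeddedManifold (g2 ħ) n)

/-- Noncommutative minimal surfaces: the coordinates are harmonic,
`h(e_u, e_u) = h(e_v, e_v)`, and `h(e_u, e_v)` is antihermitian, where `e_u = ∂_u X` and
`e_v = ∂_v X`. -/
structure IsMinimalSurface : Prop where
  harmonic : ∀ i, du ħ (du ħ (E.X i)) + dv ħ (dv ħ (E.X i)) = 0
  diag : E.h (E.phi (delU ħ)) (E.phi (delU ħ)) = E.h (E.phi (delV ħ)) (E.phi (delV ħ))
  off_diag : -star (E.h (E.phi (delU ħ)) (E.phi (delV ħ))) =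
    E.h (E.phi (delU ħ)) (E.phi (delV ħ))

/-- `Φ = ∂X`. -/
noncomputable def Phi : E.tangent := E.phi (del ħ)

/-- `Φ̄ = ∂̄X`. -/
noncomputable def PhiBar : E.tangent := E.phi (delBar ħ)

/-- `S = h(Φ, Φ)`. -/
noncomputable def S : FractionField ħ := E.h E.Phi E.Phi

/-- `T = h(Φ̄, Φ̄)`. -/
noncomputable def T : FractionField ħ := E.h E.PhiBar E.PhiBar

end EmbeddedManifold

end NCMinimal

open NCMinimal
open scoped RightActions

/-! The module `TΣ` is free on the orthogonal pair `Φ`, `Φ̄`, so a connection is the same thing as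
four freely chosen vector fields, and only finitely many identities decide whether it is
Levi-Civita.

Orthogonality is the conformality part of minimality: `4 h(Φ̄, Φ) = h(e_u, e_u) - h(e_v, e_v) - i
(h(e_u, e_v) + h(e_v, e_u))`, and both groups vanish (`IsMinimalSurface.h_PhiBar_Phi`). Pairing a
relation between `Φ` and `Φ̄` with each of them then kills its coefficients, because `S` and `T` are
nonzero in a skew field. Since `∂`, `∂̄` is also a basis of `𝔤₂`, the values of `∇` on these bases
may be prescribed arbitrarily (`IsMinimalSurface.exists_connection`), and they determine `∇`
(`Connection.ext_of_span`).

Metric compatibility and torsion freeness propagate from generators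
(`Connection.isHermitian_of_span`, `isTorsionFree_of_span`). As `∂* = ∂̄`, compatibility amounts to
eight scalar equations. In each, the factors `S⁻¹` and `T⁻¹` cancel against `S` and `T`, and every
`γ` term meets its negative because `i* = -i`; the terms `Φ S⁻¹ ∂S` and `Φ̄ T⁻¹ ∂̄T` account for the
derivatives of `S` and `T`. Torsion freeness is the equality `∇_∂ Φ̄ = ∇_∂̄ Φ`, since `𝔤₂` is
abelian. -/

namespace NCMinimal

/-! ### Formal rules for hermitian forms and Lie pairs. -/

section General

variable {A : Type*} [Ring A] [StarRing A]

namespace HermitianForm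

variable {M : Type*} [AddCommGroup M] [Module Aᵐᵒᵖ M] (h : HermitianForm A M)

/-- The axioms give additivity in one slot and right linearity in the other; the symmetry `h(x, y)*
= h(y, x)` carries each across. -/
theorem apply_add (m m₁ m₂ : M) : h m (m₁ + m₂) = h m m₁ + h m m₂ := by
  rw [← h.star_apply, h.add_apply, star_add, h.star_apply, h.star_apply]

theorem smul_apply (m₁ m₂ : M) (a : A) : h (m₁ <• a) m₂ = star a * h m₁ m₂ := by
  rw [← h.star_apply, h.apply_smul, star_mul, h.star_apply]

theorem apply_zero (m : M) : h m 0 = 0 := by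
  simpa using h.apply_smul m 0 0

theorem zero_apply (m : M) : h 0 m = 0 := by
  rw [← h.star_apply, apply_zero, star_zero]

end HermitianForm

variable [Algebra ℂ A] [StarModule ℂ A]

namespace LiePair

variable (g : LiePair A)

/-- The Leibniz rule on `1 * 1` gives `d 1 = d 1 + d 1`. Constants therefore contribute no
derivative term when a connection is applied to `φ(z d)` or to a basis vector. -/
theorem apply_algebraMap (d : g.carrier) (z : ℂ) :
    (d : Module.End ℂ A) (algebraMap ℂ A z) = 0 := by
  have h1 : (d : Module.End ℂ A) 1 = 0 := by simpa using g.leibniz d d.2 1 1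
  rw [Algebra.algebraMap_eq_smul_one, map_smul, h1, smul_zero]

theorem star_involution_apply (d : g.carrier) (a : A) :
    star ((g.involution d : Module.End ℂ A) a) = (d : Module.End ℂ A) (star a) :=
  star_star _

theorem involution_add (d₁ d₂ : g.carrier) :
    g.involution (d₁ + d₂) = g.involution d₁ + g.involution d₂ := by
  apply Subtype.ext
  ext f
  simp [involution, starEnd]

theorem involution_smul (z : ℂ) (d : g.carrier) :
    g.involution (z • d) = star z • g.involution d := by
  apply Subtype.ext
  ext f
  simp [involution, starEnd]

theorem involution_zero : g.involution 0 = 0 := by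
  simpa using g.involution_smul 0 0

theorem zero_bracket (d : g.carrier) : g.bracket 0 d = 0 :=
  Subtype.ext (by simp [bracket])

theorem bracket_zero (d : g.carrier) : g.bracket d 0 = 0 :=
  Subtype.ext (by simp [bracket])

theorem add_bracket (d₁ d₂ d : g.carrier) :
    g.bracket (d₁ + d₂) d = g.bracket d₁ d + g.bracket d₂ d := by
  apply Subtype.ext
  simp only [bracket, Submodule.coe_add, add_mul, mul_add]
  abel

theorem bracket_add (d d₁ d₂ : g.carrier) :
    g.bracket d (d₁ + d₂) = g.bracket d d₁ + g.bracket d d₂ := by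
  apply Subtype.ext
  simp only [bracket, Submodule.coe_add, add_mul, mul_add]
  abel

theorem smul_bracket (z : ℂ) (d₁ d₂ : g.carrier) :
    g.bracket (z • d₁) d₂ = z • g.bracket d₁ d₂ :=
  Subtype.ext (by simp [bracket, smul_sub])

theorem bracket_smul (z : ℂ) (d₁ d₂ : g.carrier) :
    g.bracket d₁ (z • d₂) = z • g.bracket d₁ d₂ :=
  Subtype.ext (by simp [bracket, smul_sub])

end LiePair

/-! ### Connections: reduction to generators, and construction on free modules. -/

namespace Connection

variable {g : LiePair A} {M : Type*} [AddCommGroup M] [Module Aᵐᵒᵖ M] (nabla : Connection g M)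

theorem add_apply (d₁ d₂ : g.carrier) (m : M) : nabla (d₁ + d₂) m = nabla d₁ m + nabla d₂ m := by
  simpa using nabla.linear 1 1 d₁ d₂ m

theorem smul_apply (z : ℂ) (d : g.carrier) (m : M) :
    nabla (z • d) m = nabla d m <• algebraMap ℂ A z := by
  simpa using nabla.linear z 0 d 0 m

theorem zero_apply (m : M) : nabla 0 m = 0 := by
  simpa using nabla.smul_apply 0 0 m

theorem apply_zero (d : g.carrier) : nabla d 0 = 0 := by
  simpa using nabla.map_add d 0 0

variable {nabla}

/-- Two connections agreeing on generators are equal. -/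
theorem ext_of_span {nabla' : Connection g M} {s : Set g.carrier} {t : Set M}
    (hs : Submodule.span ℂ s = ⊤) (ht : Submodule.span Aᵐᵒᵖ t = ⊤)
    (h : ∀ d ∈ s, ∀ m ∈ t, nabla d m = nabla' d m) : nabla = nabla' := by
  suffices hfun : ∀ d m, nabla d m = nabla' d m by
    cases nabla
    cases nabla'
    congr
    exact funext₂ hfun
  intro d m
  have hd : d ∈ Submodule.span ℂ s := hs ▸ Submodule.mem_top
  have hm : m ∈ Submodule.span Aᵐᵒᵖ t := ht ▸ Submodule.mem_top
  induction hd using Submodule.span_induction with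
  | mem d hd =>
    induction hm using Submodule.span_induction with
    | mem m hm => exact h d hd m hm
    | zero => rw [apply_zero, apply_zero]
    | add x y _ _ hx hy => rw [nabla.map_add, nabla'.map_add, hx, hy]
    | smul a x _ hx =>
      -- The inhomogeneous term `x · d(a)` is the same for both connections, so their difference is
      -- right linear.
      have h1 := nabla.leibniz d x a.unop
      have h2 := nabla'.leibniz d x a.unop
      rw [MulOpposite.op_unop] at h1 h2
      rw [h1, h2, hx]
  | zero => rw [zero_apply, zero_apply]
  | add x y _ _ hx hy => rw [add_apply, add_apply, hx, hy]
  | smul z x _ hx => rw [smul_apply, smul_apply, hx]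

/-- It suffices to check that a connection is hermitian on generators. -/
theorem isHermitian_of_span {form : HermitianForm A M} {s : Set g.carrier} {t : Set M}
    (hs : Submodule.span ℂ s = ⊤) (ht : Submodule.span Aᵐᵒᵖ t = ⊤)
    (h : ∀ d ∈ s, ∀ m₁ ∈ t, ∀ m₂ ∈ t, (d : Module.End ℂ A) (form m₁ m₂) =
      form (nabla (g.involution d) m₁) m₂ + form m₁ (nabla d m₂)) :
    nabla.IsHermitian form := by
  intro d m₁ m₂
  have hd : d ∈ Submodule.span ℂ s := hs ▸ Submodule.mem_top
  have hm₁ : m₁ ∈ Submodule.span Aᵐᵒᵖ t := ht ▸ Submodule.mem_top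
  have hm₂ : m₂ ∈ Submodule.span Aᵐᵒᵖ t := ht ▸ Submodule.mem_top
  induction hd using Submodule.span_induction with
  | mem d hd =>
    induction hm₁ using Submodule.span_induction with
    | mem m₁ hm₁ =>
      induction hm₂ using Submodule.span_induction with
      | mem m₂ hm₂ => exact h d hd m₁ hm₁ m₂ hm₂
      | zero => simp [apply_zero, form.apply_zero]
      | add x y _ _ hx hy =>
        simp only [nabla.map_add, form.apply_add, _root_.map_add, hx, hy]
        abel
      | smul a x _ hx =>
        obtain ⟨a, rfl⟩ := MulOpposite.op_surjective a
        -- The term `h(m₁, x) d(a)` from the Leibniz rule of `∇` is the one that `d` produces on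
        -- `h(m₁, x) a`.
        rw [nabla.leibniz, form.apply_add, form.apply_smul, form.apply_smul, form.apply_smul,
          form.apply_smul, g.leibniz d d.2, hx]
        noncomm_ring
    | zero => simp [apply_zero, form.zero_apply]
    | add x y _ _ hx hy =>
      simp only [nabla.map_add, form.add_apply, _root_.map_add, hx, hy]
      abel
    | smul a x _ hx =>
      obtain ⟨a, rfl⟩ := MulOpposite.op_surjective a
      -- In the first slot the coefficient leaves as `(d*(a))* = d(a*)`; this is why compatibility
      -- uses `∇` along `d*` there.
      rw [nabla.leibniz, form.add_apply, form.smul_apply, form.smul_apply, form.smul_apply,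
        form.smul_apply, g.star_involution_apply, g.leibniz d d.2, hx]
      noncomm_ring
  | zero => simp [g.involution_zero, zero_apply, form.apply_zero, form.zero_apply]
  | add x y _ _ hx hy =>
    simp only [g.involution_add, add_apply, form.add_apply, form.apply_add, Submodule.coe_add,
      LinearMap.add_apply, hx, hy]
    abel
  | smul z x _ hx =>
    -- Both `d ↦ d*` and the first slot of the form are conjugate linear, so the two conjugations
    -- cancel and each side is linear in `d`.
    simp only [g.involution_smul, smul_apply, form.smul_apply, form.apply_smul,
      Submodule.coe_smul, LinearMap.smul_apply, hx, Algebra.algebraMap_eq_smul_one, star_smul,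
      star_star, star_one, smul_mul_assoc, mul_smul_comm, one_mul, mul_one, smul_add]

/-- The connection on a free module with given values on a basis of the Lie algebra and a basis of
the module. -/
noncomputable def ofBasis {ι κ : Type*} [Fintype ι] [Fintype κ] (e : Module.Basis ι ℂ g.carrier)
    (b : Module.Basis κ Aᵐᵒᵖ M) (Γ : ι → κ → M) : Connection g M where
  toFun d m := ∑ k, (b k <• (d : Module.End ℂ A) (b.repr m k).unop +
    b.repr m k • ∑ j, Γ j k <• algebraMap ℂ A (e.repr d j))
  map_add d m₁ m₂ := by
    simp only [_root_.map_add, Finsupp.add_apply, MulOpposite.unop_add, MulOpposite.op_add, add_smul,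
      ← Finset.sum_add_distrib]
    exact Finset.sum_congr rfl fun k _ => by abel
  linear z₁ z₂ d₁ d₂ m := by
    -- The coefficients from `𝔤` act before the coordinate of `m`; centrality of `ℂ` in `A` lets
    -- them be pulled outside.
    have hz (z : ℂ) (a : Aᵐᵒᵖ) (x : M) : a • x <• algebraMap ℂ A z =
        (a • x) <• algebraMap ℂ A z := by
      rw [smul_smul, smul_smul]
      congr 1
      exact MulOpposite.unop_injective (Algebra.commutes z a.unop)
    have hd (z : ℂ) (x : A) (m : M) : m <• (z • x) = (m <• x) <• algebraMap ℂ A z := by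
      rw [smul_smul, ← MulOpposite.op_mul, ← Algebra.commutes, ← Algebra.smul_def]
    have hΓ (k : κ) : ∑ j, Γ j k <• algebraMap ℂ A (e.repr (z₁ • d₁ + z₂ • d₂) j) =
        (∑ j, Γ j k <• algebraMap ℂ A (e.repr d₁ j)) <• algebraMap ℂ A z₁ +
          (∑ j, Γ j k <• algebraMap ℂ A (e.repr d₂ j)) <• algebraMap ℂ A z₂ := by
      rw [Finset.smul_sum, Finset.smul_sum, ← Finset.sum_add_distrib]
      refine Finset.sum_congr rfl fun j _ => ?_
      rw [smul_smul, smul_smul, ← MulOpposite.op_mul, ← MulOpposite.op_mul, ← map_mul, ← map_mul,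
        ← add_smul, ← MulOpposite.op_add, ← _root_.map_add]
      simp [mul_comm]
    rw [Finset.smul_sum, Finset.smul_sum, ← Finset.sum_add_distrib]
    refine Finset.sum_congr rfl fun k _ => ?_
    rw [hΓ, Submodule.coe_add, Submodule.coe_smul, Submodule.coe_smul, LinearMap.add_apply,
      LinearMap.smul_apply, LinearMap.smul_apply, MulOpposite.op_add, add_smul, hd, hd, smul_add,
      hz, hz, smul_add, smul_add]
    abel
  leibniz d m a := by
    -- Once `m · d(a)` is isolated and expanded in the basis, the claim holds term by term by the
    -- Leibniz rule of `d` on coordinates.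
    rw [Finset.smul_sum, ← sub_eq_iff_eq_add', ← Finset.sum_sub_distrib]
    conv_rhs => rw [← b.sum_repr m, Finset.smul_sum]
    refine Finset.sum_congr rfl fun k _ => ?_
    rw [map_smul, Finsupp.smul_apply, smul_eq_mul, MulOpposite.unop_mul, MulOpposite.unop_op,
      g.leibniz d d.2, MulOpposite.op_add, add_smul, MulOpposite.op_mul, MulOpposite.op_mul,
      MulOpposite.op_unop, mul_smul, mul_smul, mul_smul, smul_add]
    abel

theorem ofBasis_apply {ι κ : Type*} [Fintype ι] [Fintype κ] (e : Module.Basis ι ℂ g.carrier)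
    (b : Module.Basis κ Aᵐᵒᵖ M) (Γ : ι → κ → M) (j : ι) (k : κ) :
    ofBasis e b Γ (e j) (b k) = Γ j k := by
  classical
  -- The coordinates of a basis vector are `0` and `1`, both killed by derivations.
  have h (l : κ) : (e j : Module.End ℂ A) (b.repr (b k) l).unop = 0 := by
    rw [b.repr_self, Finsupp.single_apply]
    split_ifs
    · simpa using g.apply_algebraMap (e j) 1
    · simp
  simp only [ofBasis, h, MulOpposite.op_zero, zero_smul, zero_add]
  rw [Finset.sum_eq_single k, Finset.sum_eq_single j]
  · simp
  · intro i _ hi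
    simp [hi.symm]
  · simp
  · intro l _ hl
    simp [Finsupp.single_apply, hl.symm]
  · simp

end Connection

end General

end NCMinimal

namespace NCMinimal

/-! ### The basis `∂`, `∂̄` of `𝔤₂`. -/

section Derivations

variable (ħ : ℝ)

theorem delU_eq : delU ħ = del ħ + delBar ħ := by
  rw [del, delBar]
  module

theorem delV_eq : delV ħ = Complex.I • (del ħ - delBar ħ) := by
  have h : del ħ - delBar ħ = (-Complex.I) • delV ħ := by
    rw [del, delBar]
    module
  rw [h, smul_smul, mul_neg, Complex.I_mul_I, neg_neg, one_smul]

theorem del_apply (f : FractionField ħ) : (del ħ : Module.End ℂ (FractionField ħ)) f =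
    (1 / 2 : ℂ) • (du ħ f - Complex.I • dv ħ f) := rfl

theorem delBar_apply (f : FractionField ħ) : (delBar ħ : Module.End ℂ (FractionField ħ)) f =
    (1 / 2 : ℂ) • (du ħ f + Complex.I • dv ħ f) := rfl

theorem span_del_delBar : Submodule.span ℂ {del ħ, delBar ħ} = ⊤ := by
  rw [eq_top_iff]
  rintro ⟨d, hd⟩ -
  obtain ⟨x, y, rfl⟩ := Submodule.mem_span_pair.1 hd
  -- Obtained by substituting `∂_u = ∂ + ∂̄` and `∂_v = i(∂ - ∂̄)`.
  refine Submodule.mem_span_pair.2 ⟨x + y * Complex.I, x - y * Complex.I, ?_⟩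
  have h : (⟨x • du ħ + y • dv ħ, hd⟩ : (g2 ħ).carrier) = x • delU ħ + y • delV ħ := rfl
  rw [h, delU_eq, delV_eq]
  module

theorem du_incl_U (hħ : ħ ≠ 0) : du ħ (FractionField.incl (WeylAlgebra.U ħ)) = 1 := by
  have h : Complex.I * (ħ : ℂ) ≠ 0 := mul_ne_zero Complex.I_ne_zero (Complex.ofReal_ne_zero.2 hħ)
  rw [du_apply, ← map_mul, ← map_mul, ← map_sub, WeylAlgebra.U_mul_V_sub, AlgHom.commutes,
    Algebra.algebraMap_eq_smul_one, smul_smul, inv_mul_cancel₀ h, one_smul]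

theorem dv_incl_V (hħ : ħ ≠ 0) : dv ħ (FractionField.incl (WeylAlgebra.V ħ)) = 1 :=
  -- `∂_u U` and `∂_v V` unfold to the same expression `(iħ)⁻¹ (UV - VU)`.
  du_incl_U ħ hħ

theorem du_incl_V : du ħ (FractionField.incl (WeylAlgebra.V ħ)) = 0 := by
  rw [du_apply, sub_self, smul_zero]

theorem dv_incl_U : dv ħ (FractionField.incl (WeylAlgebra.U ħ)) = 0 := by
  rw [dv_apply, sub_self, smul_zero]

/-- Evaluation at the pair `(U, V)` sends `∂` and `∂̄` to `(1, -i)/2` and `(1, i)/2`, which are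
independent over `ℂ`. -/
theorem linearIndependent_del_delBar (hħ : ħ ≠ 0) :
    LinearIndependent ℂ ![del ħ, delBar ħ] := by
  let ev : (g2 ħ).carrier →ₗ[ℂ] FractionField ħ × FractionField ħ :=
    ((LinearMap.applyₗ (FractionField.incl (WeylAlgebra.U ħ))).prod
      (LinearMap.applyₗ (FractionField.incl (WeylAlgebra.V ħ)))) ∘ₗ (g2 ħ).carrier.subtype
  have hev (d : (g2 ħ).carrier) : ev d =
      ((d : Module.End ℂ (FractionField ħ)) (FractionField.incl (WeylAlgebra.U ħ)),
        (d : Module.End ℂ (FractionField ħ)) (FractionField.incl (WeylAlgebra.V ħ))) := rfl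
  apply LinearIndependent.of_comp ev
  have hcomp : ev ∘ ![del ħ, delBar ħ] = ![ev (del ħ), ev (delBar ħ)] := by
    funext i
    fin_cases i <;> rfl
  rw [hcomp, LinearIndependent.pair_iff]
  intro s t hst
  simp only [hev, del_apply, delBar_apply, du_incl_U ħ hħ, dv_incl_V ħ hħ, du_incl_V, dv_incl_U,
    smul_zero, sub_zero, add_zero, zero_add, zero_sub, Prod.smul_mk, Prod.mk_add_mk,
    Prod.mk_eq_zero, smul_smul, ← add_smul, ← neg_smul, smul_eq_zero, one_ne_zero, or_false] at hst
  have hts : t - s = 0 := by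
    have h : (t - s) * Complex.I = 0 := by linear_combination 2 * hst.2
    exact (mul_eq_zero.1 h).resolve_right Complex.I_ne_zero
  exact ⟨by linear_combination hst.1 - hts / 2, by linear_combination hst.1 + hts / 2⟩

theorem bracket_g2 (d₁ d₂ : (g2 ħ).carrier) : (g2 ħ).bracket d₁ d₂ = 0 := by
  obtain ⟨d₁, h₁⟩ := d₁
  obtain ⟨d₂, h₂⟩ := d₂
  obtain ⟨x, y, rfl⟩ := Submodule.mem_span_pair.1 h₁
  obtain ⟨x', y', rfl⟩ := Submodule.mem_span_pair.1 h₂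
  apply Subtype.ext
  simp only [LiePair.bracket, mul_add, add_mul, smul_mul_assoc, mul_smul_comm, smul_add,
    du_dv_comm, Submodule.coe_zero]
  module

/-- `∂_u` and `∂_v` are hermitian and the involution is antilinear, so only the sign of `i` changes.
Compatibility thus couples `∇_∂` with `∇_∂̄`. -/
theorem involution_del : (g2 ħ).involution (del ħ) = delBar ħ := by
  have hu : (g2 ħ).involution (delU ħ) = delU ħ := Subtype.ext (starEnd_du ħ)
  have hv : (g2 ħ).involution (delV ħ) = delV ħ := Subtype.ext (starEnd_dv ħ)
  have h : del ħ = (1 / 2 : ℂ) • (delU ħ + (-Complex.I) • delV ħ) := by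
    rw [del]
    module
  rw [h, delBar, LiePair.involution_smul, LiePair.involution_add, LiePair.involution_smul, hu, hv]
  simp

theorem involution_delBar : (g2 ħ).involution (delBar ħ) = del ħ := by
  rw [← involution_del]
  apply Subtype.ext
  ext f
  simp [LiePair.involution, starEnd]

end Derivations

/-! ### Generators of the module of vector fields. -/

namespace EmbeddedManifold

section General

variable {A : Type*} [Ring A] [StarRing A] [Algebra ℂ A] [StarModule ℂ A] {g : LiePair A} {n : ℕ}
  (E : EmbeddedManifold g n)

theorem phi_add (d₁ d₂ : g.carrier) : E.phi (d₁ + d₂) = E.phi d₁ + E.phi d₂ := rfl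

theorem phi_smul (z : ℂ) (d : g.carrier) : E.phi (z • d) = E.phi d <• algebraMap ℂ A z := by
  apply Subtype.ext
  funext i
  change z • (d : Module.End ℂ A) (E.X i) = (d : Module.End ℂ A) (E.X i) * algebraMap ℂ A z
  rw [← Algebra.commutes, ← Algebra.smul_def]

theorem phi_zero : E.phi 0 = 0 := rfl

/-- `φ` is linear over `ℂ`, with scalars acting through the right module structure, so a spanning
set of `𝔤` already generates `TΣ`. -/
theorem span_phi_image {s : Set g.carrier} (hs : Submodule.span ℂ s = ⊤) :
    Submodule.span Aᵐᵒᵖ (E.phi '' s) = ⊤ := by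
  have hphi (d : g.carrier) : E.phi d ∈ Submodule.span Aᵐᵒᵖ (E.phi '' s) := by
    have hd : d ∈ Submodule.span ℂ s := hs ▸ Submodule.mem_top
    induction hd using Submodule.span_induction with
    | mem d hd => exact Submodule.subset_span ⟨d, hd, rfl⟩
    | zero => exact zero_mem _
    | add x y _ _ hx hy => exact add_mem hx hy
    | smul z x _ hx =>
      rw [phi_smul]
      exact Submodule.smul_mem _ _ hx
  rw [eq_top_iff]
  rintro ⟨m, hm⟩ -
  induction hm using Submodule.span_induction with
  | mem m hm =>
    obtain ⟨d, rfl⟩ := hm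
    exact hphi d
  | zero => exact zero_mem _
  | add x y _ _ hx hy => exact add_mem hx hy
  | smul a x _ hx => exact Submodule.smul_mem _ a hx

/-- It suffices to check torsion freeness on generators. -/
theorem isTorsionFree_of_span {nabla : Connection g E.tangent} {s : Set g.carrier}
    (hs : Submodule.span ℂ s = ⊤)
    (h : ∀ d₁ ∈ s, ∀ d₂ ∈ s,
      nabla d₁ (E.phi d₂) - nabla d₂ (E.phi d₁) = E.phi (g.bracket d₁ d₂)) :
    IsTorsionFree nabla := by
  intro d₁ d₂
  have hd₁ : d₁ ∈ Submodule.span ℂ s := hs ▸ Submodule.mem_top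
  have hd₂ : d₂ ∈ Submodule.span ℂ s := hs ▸ Submodule.mem_top
  induction hd₁ using Submodule.span_induction with
  | mem d₁ hd₁ =>
    induction hd₂ using Submodule.span_induction with
    | mem d₂ hd₂ => exact h d₁ hd₁ d₂ hd₂
    | zero =>
      rw [g.bracket_zero, phi_zero, nabla.apply_zero, nabla.zero_apply, sub_zero]
    | add x y _ _ hx hy =>
      rw [g.bracket_add, phi_add, phi_add, nabla.map_add, nabla.add_apply, ← hx, ← hy]
      abel
    | smul z x _ hx =>
      -- Since `φ(z x) = φ(x) · z` and `d₁ z = 0`, the Leibniz rule leaves no extra term.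
      rw [g.bracket_smul, phi_smul, phi_smul, nabla.leibniz, g.apply_algebraMap,
        MulOpposite.op_zero, zero_smul, add_zero, nabla.smul_apply, ← hx, smul_sub]
  | zero =>
    rw [g.zero_bracket, phi_zero, nabla.apply_zero, nabla.zero_apply, sub_zero]
  | add x y _ _ hx hy =>
    rw [g.add_bracket, phi_add, phi_add, nabla.map_add, nabla.add_apply, ← hx, ← hy]
    abel
  | smul z x _ hx =>
    rw [g.smul_bracket, phi_smul, phi_smul, nabla.leibniz, g.apply_algebraMap,
      MulOpposite.op_zero, zero_smul, add_zero, nabla.smul_apply, ← hx, smul_sub]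

end General

/-! ### The orthogonal basis `Φ`, `Φ̄` of a minimal surface. -/

variable {ħ : ℝ} {n : ℕ} (E : EmbeddedManifold (g2 ħ) n)

theorem span_Phi_PhiBar : Submodule.span (FractionField ħ)ᵐᵒᵖ {E.Phi, E.PhiBar} = ⊤ := by
  rw [← E.span_phi_image (span_del_delBar ħ), Set.image_pair]
  rfl

theorem star_S : star E.S = E.S := E.h.star_apply _ _

theorem star_T : star E.T = E.T := E.h.star_apply _ _

variable {E}

theorem IsMinimalSurface.h_PhiBar_Phi (hE : E.IsMinimalSurface) : E.h E.PhiBar E.Phi = 0 := by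
  -- Antihermiticity of `h(e_u, e_v)`, read through the symmetry of the form.
  have huv : E.h (E.phi (delV ħ)) (E.phi (delU ħ)) = -E.h (E.phi (delU ħ)) (E.phi (delV ħ)) := by
    rw [← E.h.star_apply, ← hE.off_diag, star_neg, star_star, hE.off_diag]
  have h1 : E.Phi =
      (E.phi (delU ħ) + E.phi (delV ħ) <• algebraMap ℂ (FractionField ħ) (-Complex.I)) <•
        algebraMap ℂ (FractionField ħ) (1 / 2) := by
    rw [← phi_smul, ← phi_add, ← phi_smul, Phi, del]
    congr 1
    module
  have h2 : E.PhiBar =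
      (E.phi (delU ħ) + E.phi (delV ħ) <• algebraMap ℂ (FractionField ħ) Complex.I) <•
        algebraMap ℂ (FractionField ħ) (1 / 2) := by
    rw [← phi_smul, ← phi_add, ← phi_smul]
    rfl
  rw [h1, h2]
  simp only [HermitianForm.smul_apply, HermitianForm.apply_smul, HermitianForm.add_apply,
    HermitianForm.apply_add, huv, hE.diag, Algebra.algebraMap_eq_smul_one, star_smul, star_one,
    smul_mul_assoc, mul_smul_comm, one_mul, mul_one]
  simp only [smul_add, smul_neg, smul_smul]
  -- What remains are the coefficients of `h(e_v, e_v)`, where `i² = -1` enters, and of `h(e_u,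
  -- e_v)`.
  match_scalars
  · simp
    linear_combination (1 / 4 : ℂ) * Complex.I_mul_I
  · simp
    ring

theorem IsMinimalSurface.h_Phi_PhiBar (hE : E.IsMinimalSurface) : E.h E.Phi E.PhiBar = 0 := by
  rw [← E.h.star_apply, hE.h_PhiBar_Phi, star_zero]

/-- Pairing `Φ s + Φ̄ t = 0` with `Φ` and with `Φ̄` leaves `S s = 0` and `T t = 0`, by
orthogonality. -/
theorem IsMinimalSurface.linearIndependent_Phi_PhiBar (hE : E.IsMinimalSurface) (hS : E.S ≠ 0)
    (hT : E.T ≠ 0) : LinearIndependent (FractionField ħ)ᵐᵒᵖ ![E.Phi, E.PhiBar] := by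
  rw [LinearIndependent.pair_iff]
  intro s t hst
  obtain ⟨s, rfl⟩ := MulOpposite.op_surjective s
  obtain ⟨t, rfl⟩ := MulOpposite.op_surjective t
  have h1 := congrArg (E.h E.Phi) hst
  have h2 := congrArg (E.h E.PhiBar) hst
  rw [HermitianForm.apply_add, HermitianForm.apply_smul, HermitianForm.apply_smul,
    HermitianForm.apply_zero] at h1 h2
  rw [hE.h_Phi_PhiBar, zero_mul, add_zero] at h1
  rw [hE.h_PhiBar_Phi, zero_mul, zero_add] at h2
  exact ⟨by simpa using (mul_eq_zero.1 h1).resolve_left hS,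
    by simpa using (mul_eq_zero.1 h2).resolve_left hT⟩

/-- The basis `Φ, Φ̄` of `TΣ`. -/
noncomputable def IsMinimalSurface.basis (hE : E.IsMinimalSurface) (hS : E.S ≠ 0) (hT : E.T ≠ 0) :
    Module.Basis (Fin 2) (FractionField ħ)ᵐᵒᵖ E.tangent :=
  Module.Basis.mk (hE.linearIndependent_Phi_PhiBar hS hT) (by
    rw [Matrix.range_cons_cons_empty, E.span_Phi_PhiBar])

/-- Freeness of `TΣ` means that the four values satisfy no consistency condition. -/
theorem IsMinimalSurface.exists_connection (hE : E.IsMinimalSurface) (hħ : ħ ≠ 0) (hS : E.S ≠ 0)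
    (hT : E.T ≠ 0) (m₁₁ m₁₂ m₂₁ m₂₂ : E.tangent) : ∃ nabla : Connection (g2 ħ) E.tangent,
      nabla (del ħ) E.Phi = m₁₁ ∧ nabla (del ħ) E.PhiBar = m₁₂ ∧
      nabla (delBar ħ) E.Phi = m₂₁ ∧ nabla (delBar ħ) E.PhiBar = m₂₂ := by
  let e : Module.Basis (Fin 2) ℂ (g2 ħ).carrier :=
    Module.Basis.mk (linearIndependent_del_delBar ħ hħ) (by
      rw [Matrix.range_cons_cons_empty, span_del_delBar])
  let b := hE.basis hS hT
  have he0 : e 0 = del ħ := Module.Basis.mk_apply _ _ _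
  have he1 : e 1 = delBar ħ := Module.Basis.mk_apply _ _ _
  have hb0 : b 0 = E.Phi := Module.Basis.mk_apply _ _ _
  have hb1 : b 1 = E.PhiBar := Module.Basis.mk_apply _ _ _
  have h := Connection.ofBasis_apply e b ![![m₁₁, m₁₂], ![m₂₁, m₂₂]]
  refine ⟨Connection.ofBasis e b ![![m₁₁, m₁₂], ![m₂₁, m₂₂]], ?_⟩
  rw [← he0, ← he1, ← hb0, ← hb1]
  exact ⟨h 0 0, h 0 1, h 1 0, h 1 1⟩

end EmbeddedManifold

end NCMinimal

/-- The equivalence for all `nabla'` encodes "exactly one": taking `nabla' = nabla` yields the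
formulas, and the converse direction yields uniqueness. -/
theorem mainTheorem5 (ħ : ℝ) (hħ : 0 < ħ) (n : ℕ) (E : EmbeddedManifold (g2 ħ) n)
    (hmin : E.IsMinimalSurface)
    (hcomm : ∀ i : Fin n, Commute ((E.Phi : Fin n → FractionField ħ) i)
      ((del ħ : Module.End ℂ (FractionField ħ)) ((E.Phi : Fin n → FractionField ħ) i)))
    (hS : E.S ≠ 0) (hT : E.T ≠ 0) (γ₁ γ₂ : FractionField ħ) :
    ∃ nabla : Connection (g2 ħ) E.tangent,
      (∀ nabla' : Connection (g2 ħ) E.tangent, nabla' = nabla ↔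
        nabla' (del ħ) E.Phi =
            E.Phi <• (E.S⁻¹ * (del ħ : Module.End ℂ (FractionField ħ)) E.S) +
            E.Phi <• (Complex.I • (E.S⁻¹ * γ₁)) +
            E.PhiBar <• (Complex.I • (E.T⁻¹ * γ₂)) ∧
        nabla' (delBar ħ) E.PhiBar =
            E.PhiBar <• (E.T⁻¹ * (delBar ħ : Module.End ℂ (FractionField ħ)) E.T) +
            E.Phi <• (Complex.I • (E.S⁻¹ * star γ₂)) +
            E.PhiBar <• (Complex.I • (E.T⁻¹ * star γ₁)) ∧
        nabla' (del ħ) E.PhiBar =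
            E.Phi <• (Complex.I • (E.S⁻¹ * star γ₁)) +
            E.PhiBar <• (Complex.I • (E.T⁻¹ * γ₁)) ∧
        nabla' (delBar ħ) E.Phi =
            E.Phi <• (Complex.I • (E.S⁻¹ * star γ₁)) +
            E.PhiBar <• (Complex.I • (E.T⁻¹ * γ₁))) ∧
      EmbeddedManifold.IsLeviCivita nabla := by
  obtain ⟨nabla, h1, h2, h3, h4⟩ := hmin.exists_connection hħ.ne' hS hT
    (E.Phi <• (E.S⁻¹ * (del ħ : Module.End ℂ (FractionField ħ)) E.S) +
      E.Phi <• (Complex.I • (E.S⁻¹ * γ₁)) + E.PhiBar <• (Complex.I • (E.T⁻¹ * γ₂)))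
    (E.Phi <• (Complex.I • (E.S⁻¹ * star γ₁)) + E.PhiBar <• (Complex.I • (E.T⁻¹ * γ₁)))
    (E.Phi <• (Complex.I • (E.S⁻¹ * star γ₁)) + E.PhiBar <• (Complex.I • (E.T⁻¹ * γ₁)))
    (E.PhiBar <• (E.T⁻¹ * (delBar ħ : Module.End ℂ (FractionField ħ)) E.T) +
      E.Phi <• (Complex.I • (E.S⁻¹ * star γ₂)) + E.PhiBar <• (Complex.I • (E.T⁻¹ * star γ₁)))
  refine ⟨nabla, fun nabla' => ⟨?_, ?_⟩, ?_, ?_⟩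
  · rintro rfl
    exact ⟨h1, h4, h2, h3⟩
  · rintro ⟨h1', h4', h2', h3'⟩
    refine Connection.ext_of_span (span_del_delBar ħ) E.span_Phi_PhiBar ?_
    rintro d (rfl | rfl) m (rfl | rfl)
    · rw [h1, h1']
    · rw [h2, h2']
    · rw [h3, h3']
    · rw [h4, h4']
  · have hSS : E.h E.Phi E.Phi = E.S := rfl
    have hTT : E.h E.PhiBar E.PhiBar = E.T := rfl
    -- After the rewriting below these say `(∂̄T)* = ∂(T*)` and `(∂S)* = ∂̄(S*)`; with `S` and `T`
    -- hermitian they turn the starred correction terms into the required derivatives.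
    have hdT := (g2 ħ).star_involution_apply (del ħ) E.T
    have hdS' := (g2 ħ).star_involution_apply (delBar ħ) E.S
    rw [involution_del] at hdT
    rw [involution_delBar] at hdS'
    refine Connection.isHermitian_of_span (span_del_delBar ħ) E.span_Phi_PhiBar ?_
    rintro d (rfl | rfl) m₁ (rfl | rfl) m₂ (rfl | rfl)
    -- Eight equations, one for each choice of derivation and of two basis vectors; the closing
    -- `simp` cancels the opposite `γ` terms.
    all_goals
      simp only [involution_del, involution_delBar, h1, h2, h3, h4, HermitianForm.add_apply,
        HermitianForm.apply_add, HermitianForm.smul_apply, HermitianForm.apply_smul, hSS, hTT,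
        hmin.h_PhiBar_Phi, hmin.h_Phi_PhiBar, star_mul, star_smul, star_inv₀, E.star_S, E.star_T,
        star_star, mul_zero, zero_mul, add_zero, zero_add, smul_mul_assoc, mul_smul_comm,
        inv_mul_cancel_right₀ hS, inv_mul_cancel_right₀ hT, mul_inv_cancel_left₀ hS,
        mul_inv_cancel_left₀ hT, hdT, hdS', map_zero]
      simp
  · refine E.isTorsionFree_of_span (span_del_delBar ħ) ?_
    have h23 : nabla (del ħ) (E.phi (delBar ħ)) = nabla (delBar ħ) (E.phi (del ħ)) :=
      h2.trans h3.symm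
    rintro d₁ (rfl | rfl) d₂ (rfl | rfl) <;>
      simp [bracket_g2, EmbeddedManifold.phi_zero, h23]
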